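/- Let $K\in(0,1]$, let $[\mu,\nu]\subset(0,1)$, and let $H:[0,\infty)\to[\mu,\nu]$ be a (globally) Hölder continuous function with exponent $\beta>0$ such that $\sup_{t\ge 0}H(t)<\beta$. Put $$D(x,y)=\frac{\sqrt{\Gamma(2x+1)\Gamma(2y+1)\sin(\pi x)\sin(\pi y)}}{2\,\Gamma(x+y+1)\sin\left(\frac{\pi(x+y)}{2}\right)},\qquad x,y\in(0,1),$$ and let $B^{H(\cdot),K}=(B^{H(t),K}_t)_{t\ge0}$ be a centred Gaussian process, starting from zero, with covariance function $$R^{H(\cdot),K}(t,s)=D(H(t),H(s))^K\left[\left(t^{H(t)+H(s)}+s^{H(t)+H(s)}\right)^K-|t-s|^{(H(t)+H(s))K}\right],\qquad s,t\ge0.$$ Then there exists $\delta>0$ and, for every integer $m\ge1$, a constant $M_m>0$ such that $$\mathbb{E}\left|B^{H(t),K}_t-B^{H(s),K}_s\right|^m\ \ge\ M_m\,|t-s|^{m\,(H(t)\wedge H(s))\,K}$$ for all $s,t\ge0$ with $|t-s|<\delta$. -/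

import Mathlib

open MeasureTheory ProbabilityTheory
open scoped NNReal

/-- The normalising factor `D(x, y)` of the covariance of standard multifractional
Brownian motion, for `x, y ∈ (0, 1)`. -/
noncomputable def mbmD (x y : ℝ) : ℝ :=
  Real.sqrt (Real.Gamma (2 * x + 1) * Real.Gamma (2 * y + 1) *
      Real.sin (Real.pi * x) * Real.sin (Real.pi * y)) /
    (2 * Real.Gamma (x + y + 1) * Real.sin (Real.pi * (x + y) / 2))

/-- The covariance function `R^{H(·),K}(t, s)`, for a Hurst function `H` on `[0, ∞)`. -/
noncomputable def bifractionalCov (H : ℝ≥0 → ℝ) (K : ℝ) (t s : ℝ≥0) : ℝ :=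
  mbmD (H t) (H s) ^ K *
    (((t : ℝ) ^ (H t + H s) + (s : ℝ) ^ (H t + H s)) ^ K -
      |(t : ℝ) - (s : ℝ)| ^ ((H t + H s) * K))

/-- `B` is, under `P`, a process `B^{H(·),K}`: a centred Gaussian process, starting from zero,
with covariance function `R^{H(·),K}`. -/
structure IsMultifractionalBifractionalBM {Ω : Type*} [MeasurableSpace Ω]
    (H : ℝ≥0 → ℝ) (K : ℝ) (B : ℝ≥0 → Ω → ℝ) (P : Measure Ω) : Prop where
  isGaussianProcess : IsGaussianProcess B P
  centred : ∀ t, ∫ ω, B t ω ∂P = 0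
  start_zero : ∀ᵐ ω ∂P, B 0 ω = 0
  covariance_eq : ∀ t s, cov[B t, B s; P] = bifractionalCov H K t s

/-!
Write `x = H(t)`, `y = H(s)`, `a = x + y`, `b = a K` and `d = |t - s|`. An increment is a centred
Gaussian variable, so its `m`-th absolute moment is the `m`-th power of its standard deviation times
a positive constant (`integral_abs_pow_of_hasGaussianLaw`), and everything reduces to a lower bound
`c d^(2 (x ∧ y) K)` for its variance
`t^(2xK) + s^(2yK) - 2 D(x, y)^K ((t^a + s^a)^K - d^b)`.

Three facts give the bound.

* `D ≤ 1/2` everywhere (`mbmD_le_half`). This says that `x ↦ Γ(2x + 1) sin(πx)` is midpoint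
  log-concave on `(0, 1)`. By the duplication and reflection formulas this function is, up to an
  exponential, `x Γ(x + 1/2) / Γ(1 - x)`, and Euler's limit formula writes the latter as a limit of
  products of log-concave factors. Hence `D` may be replaced by `1/2` for all `t`, `s`, however
  large; a bound on `|D - 1/2|` in terms of `|x - y|` would not be uniform in time.
* If moreover both exponents `2xK`, `2yK` are replaced by their mean `b`, the result is at least
  `c d^b` (`exists_bifractional_lower_bound`): it is the variance of an increment of a bifractional
  Brownian motion with constant parameter `a / 2`.
* Passing to the mean exponent costs only `O(d^(b + η))` for some `η > 0`
  (`neg_rpow_le_rpow_perturbation`). To first order the cost is `|x - y| K` times the increment of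
  `u^b log u`; since `|x - y| = O(d^β)`, this suffices for bounded times, by `H < β`. For large
  times the increment is unbounded, but the second-order term `(x - y)² K² s^b log² s / 2` of the
  convex function `p ↦ s^p` has the good sign and absorbs it.

Finally `d^b` and `d^(2 (x ∧ y) K)` are comparable because `d^|x - y|` is bounded below
(`exp_mul_rpow_min_le_rpow_add`).
-/

/-! ### Log-concavity of `Γ(2x + 1) sin(πx)` and the bound `D ≤ 1/2` -/

/-- `Q_n(x) = x ∏_{j<n} (1 - x + j) / ∏_{j≤n} (x + 1/2 + j)` is midpoint log-concave, because each
of the factors `x / (x + 1/2)` and `(j + 1 - x) / (j + 3/2 + x)` is. -/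
lemma prod_ratio_mul_le_sq {x y : ℝ} (hx : x ∈ Set.Ioo (0 : ℝ) 1) (hy : y ∈ Set.Ioo (0 : ℝ) 1)
    (n : ℕ) :
    (x * (∏ j ∈ Finset.range n, (1 - x + j)) / ∏ j ∈ Finset.range (n + 1), (x + 1 / 2 + j)) *
      (y * (∏ j ∈ Finset.range n, (1 - y + j)) / ∏ j ∈ Finset.range (n + 1), (y + 1 / 2 + j)) ≤
    ((x + y) / 2 * (∏ j ∈ Finset.range n, (1 - (x + y) / 2 + j)) /
      ∏ j ∈ Finset.range (n + 1), ((x + y) / 2 + 1 / 2 + j)) ^ 2 := by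
  obtain ⟨hx0, hx1⟩ := hx
  obtain ⟨hy0, hy1⟩ := hy
  induction n with
  | zero =>
    simp only [Finset.range_zero, Finset.prod_empty, mul_one, zero_add, Finset.range_one,
      Finset.prod_singleton, Nat.cast_zero, add_zero]
    rw [div_mul_div_comm, div_pow, div_le_div_iff₀ (by positivity) (by positivity)]
    have h := mul_nonneg (sq_nonneg (x - y)) (by positivity : 0 ≤ x + y + 1 / 2)
    nlinarith [h]
  | succ n ih =>
    have key : ∀ z : ℝ,
        z * (∏ j ∈ Finset.range (n + 1), (1 - z + j)) /
          ∏ j ∈ Finset.range (n + 1 + 1), (z + 1 / 2 + j) =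
        (z * (∏ j ∈ Finset.range n, (1 - z + j)) / ∏ j ∈ Finset.range (n + 1), (z + 1 / 2 + j)) *
          ((1 - z + n) / (z + 1 / 2 + (n + 1))) := by
      intro z
      rw [Finset.prod_range_succ (fun j : ℕ => z + 1 / 2 + (j : ℝ)) (n + 1),
        Finset.prod_range_succ (fun j : ℕ => 1 - z + (j : ℝ)) n, ← mul_assoc, mul_div_mul_comm]
      push_cast
      rfl
    rw [key x, key y, key ((x + y) / 2), mul_pow, mul_mul_mul_comm]
    have hn : (0 : ℝ) ≤ n := n.cast_nonneg
    have hx1' : 0 < 1 - x + n := by linarith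
    have hy1' : 0 < 1 - y + n := by linarith
    refine mul_le_mul ih ?_ (by positivity) (by positivity)
    rw [div_mul_div_comm, div_pow, div_le_div_iff₀ (by positivity) (by positivity)]
    have h := mul_nonneg (sq_nonneg (x - y))
      (by positivity : 0 ≤ ((n : ℝ) + n + 5 / 2) * (x + y + 1 / 2))
    nlinarith [h]

/-- Euler's limit formula turns the finite products into `x Γ(x + 1/2) / Γ(1 - x)`. -/
lemma gamma_ratio_mul_le_sq {x y : ℝ} (hx : x ∈ Set.Ioo (0 : ℝ) 1) (hy : y ∈ Set.Ioo (0 : ℝ) 1) :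
    (x * Real.Gamma (x + 1 / 2) / Real.Gamma (1 - x)) *
      (y * Real.Gamma (y + 1 / 2) / Real.Gamma (1 - y)) ≤
    ((x + y) / 2 * Real.Gamma ((x + y) / 2 + 1 / 2) / Real.Gamma (1 - (x + y) / 2)) ^ 2 := by
  have hlim : ∀ z : ℝ, z ∈ Set.Ioo (0 : ℝ) 1 → Filter.Tendsto
      (fun n => z * Real.GammaSeq (z + 1 / 2) n / Real.GammaSeq (1 - z) n) Filter.atTop
      (nhds (z * Real.Gamma (z + 1 / 2) / Real.Gamma (1 - z))) := fun z hz =>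
    ((Real.GammaSeq_tendsto_Gamma _).const_mul z).div (Real.GammaSeq_tendsto_Gamma _)
      (Real.Gamma_pos_of_pos (by linarith [hz.2])).ne'
  have hm : (x + y) / 2 ∈ Set.Ioo (0 : ℝ) 1 := ⟨by linarith [hx.1, hy.1], by linarith [hx.2, hy.2]⟩
  refine le_of_tendsto_of_tendsto ((hlim x hx).mul (hlim y hy)) ((hlim _ hm).pow 2) ?_
  filter_upwards [Filter.eventually_gt_atTop 0] with n hn
  have hn0 : (0 : ℝ) < n := by exact_mod_cast hn
  have key : ∀ z : ℝ, z ∈ Set.Ioo (0 : ℝ) 1 →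
      z * Real.GammaSeq (z + 1 / 2) n / Real.GammaSeq (1 - z) n =
        (n : ℝ) ^ (2 * z - 1 / 2) * ((z * (∏ j ∈ Finset.range n, (1 - z + j)) /
          ∏ j ∈ Finset.range (n + 1), (z + 1 / 2 + j)) * (1 - z + n)) := by
    intro z hz
    have h1 : ∏ j ∈ Finset.range (n + 1), (1 - z + (j : ℝ)) ≠ 0 :=
      Finset.prod_ne_zero_iff.2 fun j _ => by
        have hj : (0 : ℝ) ≤ j := j.cast_nonneg
        have : 0 < 1 - z + (j : ℝ) := by linarith [hz.2]
        exact this.ne'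
    have h2 : ∏ j ∈ Finset.range (n + 1), (z + 1 / 2 + (j : ℝ)) ≠ 0 :=
      Finset.prod_ne_zero_iff.2 fun j _ => by
        have := hz.1
        positivity
    have h3 : (n : ℝ) ^ (2 * z - 1 / 2) * (n : ℝ) ^ (1 - z) = (n : ℝ) ^ (z + 1 / 2) := by
      rw [← Real.rpow_add hn0]; ring_nf
    have h4 : (n.factorial : ℝ) ≠ 0 := by positivity
    have h5 : (n : ℝ) ^ (1 - z) ≠ 0 := by positivity
    rw [Real.GammaSeq, Real.GammaSeq, ← h3]
    have h6 := Finset.prod_range_succ (fun j : ℕ => 1 - z + (j : ℝ)) n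
    set A := ∏ j ∈ Finset.range (n + 1), (1 - z + (j : ℝ))
    set B := ∏ j ∈ Finset.range (n + 1), (z + 1 / 2 + (j : ℝ))
    rw [div_mul_eq_mul_div, mul_assoc z, ← h6]
    field_simp
  -- the powers of `n` are log-linear in `z`, and `z ↦ 1 - z + n` is concave
  rw [key x hx, key y hy, key _ hm, mul_mul_mul_comm, mul_pow, mul_mul_mul_comm _ (1 - x + n)]
  have hx1 : 0 < 1 - x + n := by linarith [hx.2]
  have hy1 : 0 < 1 - y + n := by linarith [hy.2]
  refine mul_le_mul ?_ ?_ ?_ (by positivity)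
  · rw [← Real.rpow_add hn0, ← Real.rpow_natCast, ← Real.rpow_mul hn0.le]
    exact le_of_eq (by push_cast; ring_nf)
  · rw [mul_pow]
    refine mul_le_mul (prod_ratio_mul_le_sq hx hy n) ?_ (by positivity) (by positivity)
    nlinarith [sq_nonneg (x - y)]
  · have hp : ∀ z : ℝ, z ∈ Set.Ioo (0 : ℝ) 1 → 0 ≤ z * (∏ j ∈ Finset.range n, (1 - z + j)) /
          ∏ j ∈ Finset.range (n + 1), (z + 1 / 2 + (j : ℝ)) := by
      intro z hz
      have := hz.1
      refine div_nonneg (mul_nonneg hz.1.le (Finset.prod_nonneg fun j _ => ?_))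
        (Finset.prod_nonneg fun j _ => by positivity)
      linarith [hz.2, (j.cast_nonneg : (0 : ℝ) ≤ j)]
    exact mul_nonneg (mul_nonneg (hp x hx) (hp y hy)) (by positivity)

/-- The duplication and reflection formulas for `Γ`. -/
lemma gamma_mul_sin_eq {x : ℝ} (hx : x ∈ Set.Ioo (0 : ℝ) 1) :
    Real.Gamma (2 * x + 1) * Real.sin (Real.pi * x) =
      √Real.pi * 2 ^ (2 * x) * (x * Real.Gamma (x + 1 / 2) / Real.Gamma (1 - x)) := by
  obtain ⟨h0, h1⟩ := hx
  have hs : 0 < Real.sin (Real.pi * x) :=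
    Real.sin_pos_of_pos_of_lt_pi (by positivity) (by nlinarith [Real.pi_pos])
  have hG := Real.Gamma_pos_of_pos h0
  have hG1 := Real.Gamma_pos_of_pos (by linarith : 0 < 1 - x)
  have hdup := Real.Gamma_mul_Gamma_add_half x
  have hrefl := Real.Gamma_mul_Gamma_one_sub x
  have hsq := Real.mul_self_sqrt Real.pi_pos.le
  have hsp : 0 < √Real.pi := by positivity
  have h2 : (2 : ℝ) ^ (2 * x) * 2 ^ (1 - 2 * x) = 2 := by
    rw [← Real.rpow_add two_pos]; norm_num
  rw [eq_div_iff hs.ne'] at hrefl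
  rw [Real.Gamma_add_one (by positivity : 2 * x ≠ 0), ← mul_div_assoc, eq_div_iff hG1.ne']
  have h3 : Real.Gamma x * √Real.pi ≠ 0 := by positivity
  refine mul_right_cancel₀ h3 ?_
  calc _ = 2 * x * Real.Gamma (2 * x) * √Real.pi *
        (Real.Gamma x * Real.Gamma (1 - x) * Real.sin (Real.pi * x)) := by ring
    _ = 2 * x * Real.Gamma (2 * x) * √Real.pi * Real.pi := by rw [hrefl]
    _ = (2 ^ (2 * x) * 2 ^ (1 - 2 * x)) * x * Real.Gamma (2 * x) * √Real.pi *
        (√Real.pi * √Real.pi) := by rw [h2, hsq]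
    _ = √Real.pi * √Real.pi * 2 ^ (2 * x) * x *
        (Real.Gamma (2 * x) * 2 ^ (1 - 2 * x) * √Real.pi) := by ring
    _ = _ := by rw [← hdup]; ring

lemma gamma_mul_sin_pos {x : ℝ} (hx : x ∈ Set.Ioo (0 : ℝ) 1) :
    0 < Real.Gamma (2 * x + 1) * Real.sin (Real.pi * x) :=
  mul_pos (Real.Gamma_pos_of_pos (by linarith [hx.1]))
    (Real.sin_pos_of_pos_of_lt_pi (mul_pos Real.pi_pos hx.1)
      (by nlinarith [Real.pi_pos, hx.2]))

/-- Midpoint log-concavity of `x ↦ Γ(2x + 1) sin(πx)` on `(0, 1)`. -/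
lemma gamma_mul_sin_mul_le_sq {x y : ℝ} (hx : x ∈ Set.Ioo (0 : ℝ) 1)
    (hy : y ∈ Set.Ioo (0 : ℝ) 1) :
    (Real.Gamma (2 * x + 1) * Real.sin (Real.pi * x)) *
      (Real.Gamma (2 * y + 1) * Real.sin (Real.pi * y)) ≤
    (Real.Gamma (x + y + 1) * Real.sin (Real.pi * (x + y) / 2)) ^ 2 := by
  have hm : (x + y) / 2 ∈ Set.Ioo (0 : ℝ) 1 := ⟨by linarith [hx.1, hy.1], by linarith [hx.2, hy.2]⟩
  have e := gamma_mul_sin_eq hm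
  rw [show 2 * ((x + y) / 2) = x + y by ring, ← mul_div_assoc Real.pi (x + y) 2] at e
  rw [gamma_mul_sin_eq hx, gamma_mul_sin_eq hy, e, mul_mul_mul_comm, mul_pow]
  refine mul_le_mul_of_nonneg_left (gamma_ratio_mul_le_sq hx hy) (by positivity) |>.trans_eq' ?_
  congr 1
  rw [mul_pow, ← Real.rpow_natCast (2 ^ (x + y)), ← Real.rpow_mul two_pos.le,
    mul_mul_mul_comm, ← Real.rpow_add two_pos]
  push_cast
  ring_nf

lemma mbmD_nonneg {x y : ℝ} (hx : x ∈ Set.Ioo (0 : ℝ) 1) (hy : y ∈ Set.Ioo (0 : ℝ) 1) :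
    0 ≤ mbmD x y := by
  have hm : (x + y) / 2 ∈ Set.Ioo (0 : ℝ) 1 := ⟨by linarith [hx.1, hy.1], by linarith [hx.2, hy.2]⟩
  have e := gamma_mul_sin_pos hm
  rw [show 2 * ((x + y) / 2) = x + y by ring, ← mul_div_assoc Real.pi (x + y) 2] at e
  exact div_nonneg (Real.sqrt_nonneg _) (by linarith)

/-- Log-concavity of `x ↦ Γ(2x + 1) sin(πx)` says that `D ≤ 1/2`. -/
lemma mbmD_le_half {x y : ℝ} (hx : x ∈ Set.Ioo (0 : ℝ) 1) (hy : y ∈ Set.Ioo (0 : ℝ) 1) :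
    mbmD x y ≤ 1 / 2 := by
  have hm : (x + y) / 2 ∈ Set.Ioo (0 : ℝ) 1 := ⟨by linarith [hx.1, hy.1], by linarith [hx.2, hy.2]⟩
  have e := gamma_mul_sin_pos hm
  rw [show 2 * ((x + y) / 2) = x + y by ring, ← mul_div_assoc Real.pi (x + y) 2] at e
  rw [mbmD, div_le_div_iff₀ (by linarith) two_pos, one_mul]
  have := Real.sqrt_le_sqrt (gamma_mul_sin_mul_le_sq hx hy)
  rw [Real.sqrt_sq e.le] at this
  calc _ = √(Real.Gamma (2 * x + 1) * Real.sin (Real.pi * x) *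
      (Real.Gamma (2 * y + 1) * Real.sin (Real.pi * y))) * 2 := by congr 2; ring
    _ ≤ _ := by linarith

lemma mbmD_self {x : ℝ} (hx : x ∈ Set.Ioo (0 : ℝ) 1) : mbmD x x = 1 / 2 := by
  have e := gamma_mul_sin_pos hx
  rw [mbmD, show x + x = 2 * x by ring, show Real.pi * (2 * x) / 2 = Real.pi * x by ring,
    show Real.Gamma (2 * x + 1) * Real.Gamma (2 * x + 1) * Real.sin (Real.pi * x) *
      Real.sin (Real.pi * x) = (Real.Gamma (2 * x + 1) * Real.sin (Real.pi * x)) ^ 2 by ring,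
    Real.sqrt_sq e.le, mul_assoc, div_eq_iff (by positivity)]
  ring

/-! ### Constant Hurst parameter -/

/-- The quadratic case of the lower bound. With `B = 2PQ` and `C = (P - Q)²` the right-hand side is
`(P^K - Q^K)² + 2^(1-K) (B^K + C^K - (B + C)^K)`: for `C ≤ B` and `K < 1` the concavity defect
controls `C^K`, and for `C ≥ B` the square does. -/
lemma exists_quadratic_lower_bound {K : ℝ} (hK : K ∈ Set.Ioc (0 : ℝ) 1) :
    ∃ c : ℝ, 0 < c ∧ c ≤ 1 ∧ ∀ P Q : ℝ, 0 ≤ Q → Q ≤ P →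
      c * ((P - Q) ^ 2) ^ K ≤ (P ^ 2) ^ K + (Q ^ 2) ^ K -
        2 ^ (1 - K) * ((P ^ 2 + Q ^ 2) ^ K - ((P - Q) ^ 2) ^ K) := by
  obtain ⟨hK0, hK1⟩ := hK
  -- for `K = 1` the concavity defect vanishes, but both sides equal `(P - Q)²` with `c = 1`
  rcases hK1.eq_or_lt with rfl | hK1
  · exact ⟨1, one_pos, le_rfl, fun P Q _ _ => by simp⟩
  have h2 : (2⁻¹ : ℝ) ^ K < 1 := Real.rpow_lt_one (by norm_num) (by norm_num) hK0
  have h20 : (0 : ℝ) < (2⁻¹ : ℝ) ^ K := by positivity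
  have h21 : (1 : ℝ) ≤ 2 ^ (1 - K) := Real.one_le_rpow (by norm_num) (by linarith)
  refine ⟨min ((1 - (2⁻¹ : ℝ) ^ K) ^ 2) (1 - K), lt_min (by nlinarith) (by linarith),
    (min_le_right _ _).trans (by linarith), fun P Q hQ hQP => ?_⟩
  have hP : 0 ≤ P := hQ.trans hQP
  have hpow : ∀ z : ℝ, 0 ≤ z → (z ^ 2) ^ K = (z ^ K) ^ 2 := fun z hz => by
    rw [← Real.rpow_natCast, ← Real.rpow_mul hz, mul_comm, Real.rpow_mul hz, Real.rpow_natCast]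
  set B := 2 * P * Q with hB
  set C := (P - Q) ^ 2 with hC
  have hB0 : 0 ≤ B := by positivity
  have hC0 : 0 ≤ C := by positivity
  have hBK : 2 ^ (1 - K) * B ^ K = 2 * (P ^ K * Q ^ K) := by
    rw [hB, Real.mul_rpow (by positivity) hQ, Real.mul_rpow two_pos.le hP, ← mul_assoc,
      ← mul_assoc, ← Real.rpow_add two_pos]
    simp [mul_assoc]
  rw [show P ^ 2 + Q ^ 2 = B + C by rw [hB, hC]; ring, hpow P hP, hpow Q hQ]
  have hCK : 0 ≤ C ^ K := by positivity
  rcases lt_or_ge B C with hBC | hBC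
  · have hsub : (B + C) ^ K ≤ B ^ K + C ^ K := Real.rpow_add_le_add_rpow hB0 hC0 hK0.le hK1.le
    -- `2PQ < (P - Q)²` forces `Q` to be well below `P`
    have hQ2 : Q ≤ 2⁻¹ * P := by
      by_contra! h
      rw [hB, hC] at hBC
      nlinarith [mul_nonneg (sub_nonneg.2 hQP) (sub_nonneg.2 h.le)]
    have hQK : Q ^ K ≤ (2⁻¹ : ℝ) ^ K * P ^ K := by
      rw [← Real.mul_rpow (by norm_num) hP]
      exact Real.rpow_le_rpow hQ hQ2 hK0.le
    have hCP : C ^ K ≤ (P ^ K) ^ 2 := by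
      rw [← hpow P hP]
      exact Real.rpow_le_rpow hC0 (by rw [hC]; nlinarith) hK0.le
    have hPK : 0 ≤ P ^ K := by positivity
    have hsq : (1 - (2⁻¹ : ℝ) ^ K) ^ 2 * (P ^ K) ^ 2 ≤ (P ^ K - Q ^ K) ^ 2 := by
      rw [← mul_pow]
      exact pow_le_pow_left₀ (mul_nonneg (by linarith) hPK) (by linarith) 2
    calc _ ≤ (1 - (2⁻¹ : ℝ) ^ K) ^ 2 * C ^ K :=
          mul_le_mul_of_nonneg_right (min_le_left _ _) hCK
      _ ≤ (P ^ K - Q ^ K) ^ 2 := (mul_le_mul_of_nonneg_left hCP (sq_nonneg _)).trans hsq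
      _ ≤ _ := by
        have := mul_le_mul_of_nonneg_left hsub (zero_le_one.trans h21)
        nlinarith
  · have hsub : (B + C) ^ K ≤ B ^ K + K * C ^ K := by
      rcases hB0.eq_or_lt with h | h
      · have : C = 0 := by linarith
        rw [← h, this]
        simp [Real.zero_rpow hK0.ne']
      · have hr0 : 0 ≤ C / B := by positivity
        have hr1 : C / B ≤ 1 := (div_le_one h).2 hBC
        have e : B + C = B * (1 + C / B) := by field_simp
        have e2 : C = B * (C / B) := by field_simp
        have h1 := rpow_one_add_le_one_add_mul_self (by linarith : -1 ≤ C / B) hK0.le hK1.le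
        have h2 : C / B ≤ (C / B) ^ K := by
          simpa using Real.rpow_le_rpow_of_exponent_ge' hr0 hr1 hK0.le hK1.le
        have h3 : C ^ K = B ^ K * (C / B) ^ K := by rw [← Real.mul_rpow hB0 hr0, ← e2]
        rw [e, Real.mul_rpow hB0 (by positivity), h3]
        have hBK0 : 0 ≤ B ^ K := by positivity
        nlinarith [mul_le_mul_of_nonneg_left h1 hBK0,
          mul_le_mul_of_nonneg_left h2 (mul_nonneg hBK0 hK0.le)]
    calc _ ≤ (1 - K) * C ^ K := mul_le_mul_of_nonneg_right (min_le_right _ _) hCK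
      _ ≤ 2 ^ (1 - K) * ((1 - K) * C ^ K) :=
        le_mul_of_one_le_left (mul_nonneg (by linarith) hCK) h21
      _ ≤ _ := by
        have := mul_le_mul_of_nonneg_left hsub (zero_le_one.trans h21)
        nlinarith [sq_nonneg (P ^ K - Q ^ K)]

/-- The lower bound for the variance of an increment of bifractional Brownian motion with the
constant Hurst parameter `a / 2`. Subadditivity of `u ↦ u^(a/2)` reduces it to the quadratic case
with `P = t^(a/2)` and `Q = s^(a/2)`. -/
lemma exists_bifractional_lower_bound {K : ℝ} (hK : K ∈ Set.Ioc (0 : ℝ) 1) :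
    ∃ c : ℝ, 0 < c ∧ ∀ a t s : ℝ, 0 < a → a ≤ 2 → 0 ≤ s → s ≤ t →
      c * (t - s) ^ (a * K) ≤ t ^ (a * K) + s ^ (a * K) -
        2 ^ (1 - K) * ((t ^ a + s ^ a) ^ K - (t - s) ^ (a * K)) := by
  obtain ⟨c, hc, hc1, h⟩ := exists_quadratic_lower_bound hK
  obtain ⟨hK0, hK1⟩ := hK
  refine ⟨c, hc, fun a t s ha ha2 hs hst => ?_⟩
  have ht : 0 ≤ t := hs.trans hst
  have hd : 0 ≤ t - s := by linarith
  have hsq : ∀ z : ℝ, 0 ≤ z → (z ^ (a / 2)) ^ 2 = z ^ a := fun z hz => by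
    rw [← Real.rpow_natCast, ← Real.rpow_mul hz]; norm_num
  have h1 := h (t ^ (a / 2)) (s ^ (a / 2)) (by positivity)
    (Real.rpow_le_rpow hs hst (by positivity))
  have hsub : t ^ (a / 2) - s ^ (a / 2) ≤ (t - s) ^ (a / 2) := by
    have := Real.rpow_add_le_add_rpow hd hs (by positivity : 0 ≤ a / 2) (by linarith)
    rw [sub_add_cancel] at this
    linarith
  have hle : ((t ^ (a / 2) - s ^ (a / 2)) ^ 2) ^ K ≤ (t - s) ^ (a * K) := by
    rw [Real.rpow_mul hd, ← hsq _ hd]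
    refine Real.rpow_le_rpow (sq_nonneg _) (pow_le_pow_left₀ ?_ hsub 2) hK0.le
    linarith [Real.rpow_le_rpow hs hst (by positivity : 0 ≤ a / 2)]
  rw [hsq _ ht, hsq _ hs, ← Real.rpow_mul ht, ← Real.rpow_mul hs] at h1
  have h21 : (1 : ℝ) ≤ 2 ^ (1 - K) := Real.one_le_rpow (by norm_num) (by linarith)
  nlinarith [mul_nonneg (sub_nonneg.2 (hc1.trans h21)) (sub_nonneg.2 hle)]

/-! ### Perturbation of the exponents -/

/-- Convexity of `p ↦ u^p`. At `u = 0` both sides vanish. -/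
lemma mul_rpow_mul_log_le_rpow_sub {u p q : ℝ} (hu : 0 ≤ u) (hp : 0 < p) (hq : 0 < q) :
    (p - q) * (u ^ q * Real.log u) ≤ u ^ p - u ^ q := by
  rcases hu.eq_or_lt with rfl | hu
  · simp [Real.zero_rpow hp.ne', Real.zero_rpow hq.ne']
  · have h1 : u ^ p = u ^ q * Real.exp (Real.log u * (p - q)) := by
      rw [← Real.rpow_def_of_pos hu, ← Real.rpow_add hu]; ring_nf
    have h2 := Real.add_one_le_exp (Real.log u * (p - q))
    have h3 : 0 ≤ u ^ q := by positivity
    rw [h1]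
    nlinarith [mul_le_mul_of_nonneg_left h2 h3]

/-- Second-order version of `mul_rpow_mul_log_le_rpow_sub`, for `u ≥ 1` and `p ≥ q`. -/
lemma mul_rpow_mul_log_add_sq_le_rpow_sub {u p q : ℝ} (hu : 1 ≤ u) (hpq : q ≤ p) :
    (p - q) * (u ^ q * Real.log u) + u ^ q * ((p - q) * Real.log u) ^ 2 / 2 ≤ u ^ p - u ^ q := by
  have hu0 : 0 < u := by linarith
  have h1 : u ^ p = u ^ q * Real.exp (Real.log u * (p - q)) := by
    rw [← Real.rpow_def_of_pos hu0, ← Real.rpow_add hu0]; ring_nf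
  have h2 := Real.quadratic_le_exp_of_nonneg
    (mul_nonneg (Real.log_nonneg hu) (sub_nonneg.2 hpq))
  have h3 : 0 ≤ u ^ q := by positivity
  rw [h1]
  nlinarith [mul_le_mul_of_nonneg_left h2 h3]

/-- `|log u| ≤ u^(-η) / η` on `(0, 1]`, in the form that also holds at `0`. -/
lemma rpow_mul_abs_log_le {u b η : ℝ} (hu : 0 ≤ u) (hu1 : u ≤ 1) (hη : 0 < η) :
    u ^ b * |Real.log u| ≤ u ^ (b - η) / η := by
  rcases hu.eq_or_lt with rfl | hu
  · simp only [Real.log_zero, abs_zero, mul_zero]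
    positivity
  · have h := (Real.abs_log_mul_self_rpow_lt u η hu hu1 hη).le
    rw [abs_mul, abs_of_pos (Real.rpow_pos_of_pos hu η)] at h
    have e : u ^ b = u ^ (b - η) * u ^ η := by rw [← Real.rpow_add hu]; ring_nf
    calc _ = u ^ (b - η) * (|Real.log u| * u ^ η) := by rw [e]; ring
      _ ≤ u ^ (b - η) * (1 / η) := mul_le_mul_of_nonneg_left h (by positivity)
      _ = _ := by ring

/-- Increments of `u ↦ u^b log u` at points of comparable size. -/
lemma abs_rpow_mul_log_sub_le {b t s : ℝ} (hb : 0 < b) (hb2 : b ≤ 2) (hs : 0 < s) (hst : s ≤ t)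
    (hts : t ≤ 2 * s) :
    |t ^ b * Real.log t - s ^ b * Real.log s| ≤
      4 * (s ^ b * ((t - s) / s)) * (1 + 2 * |Real.log s|) := by
  have ht : 0 < t := hs.trans_le hst
  have hd : 0 ≤ (t - s) / s := div_nonneg (by linarith) hs.le
  have hlog : Real.log t - Real.log s ≤ (t - s) / s := by
    rw [← Real.log_div ht.ne' hs.ne']
    refine (Real.log_le_sub_one_of_pos (by positivity)).trans_eq ?_
    field_simp
  have hlog0 : 0 ≤ Real.log t - Real.log s := sub_nonneg.2 (Real.log_le_log hs hst)
  have htb : t ^ b ≤ 4 * s ^ b := by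
    calc t ^ b ≤ (2 * s) ^ b := Real.rpow_le_rpow ht.le hts hb.le
      _ = 2 ^ b * s ^ b := Real.mul_rpow two_pos.le hs.le
      _ ≤ 2 ^ (2 : ℝ) * s ^ b := by gcongr; norm_num
      _ = 4 * s ^ b := by norm_num
  have htb0 : 0 < t ^ b := by positivity
  have hdiff : t ^ b - s ^ b ≤ t ^ b * (2 * ((t - s) / s)) := by
    have e : s ^ b = t ^ b * Real.exp (-((Real.log t - Real.log s) * b)) := by
      rw [Real.rpow_def_of_pos hs, Real.rpow_def_of_pos ht, ← Real.exp_add]; ring_nf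
    have h1 := Real.add_one_le_exp (-((Real.log t - Real.log s) * b))
    have h2 : (Real.log t - Real.log s) * b ≤ 2 * ((t - s) / s) := by nlinarith
    rw [e]
    nlinarith
  have hdiff0 : 0 ≤ t ^ b - s ^ b := sub_nonneg.2 (Real.rpow_le_rpow hs.le hst hb.le)
  calc _ = |t ^ b * (Real.log t - Real.log s) + (t ^ b - s ^ b) * Real.log s| := by ring_nf
    _ ≤ t ^ b * (Real.log t - Real.log s) + (t ^ b - s ^ b) * |Real.log s| := by
      refine (abs_add_le _ _).trans_eq ?_
      rw [abs_mul, abs_mul, abs_of_pos htb0, abs_of_nonneg hlog0, abs_of_nonneg hdiff0]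
    _ ≤ t ^ b * ((t - s) / s) + t ^ b * (2 * ((t - s) / s)) * |Real.log s| := by gcongr
    _ = t ^ b * ((t - s) / s * (1 + 2 * |Real.log s|)) := by ring
    _ ≤ 4 * s ^ b * ((t - s) / s * (1 + 2 * |Real.log s|)) := by gcongr
    _ = _ := by ring

/-- Far from the origin the first-order loss `ℓ (d / s) log s` caused by the varying exponent is
absorbed by the second-order gain `(ℓ log s)²`, up to a multiple of `(d / s)²`. -/
lemma neg_sq_le_rpow_perturbation {b ℓ t s : ℝ} (hb : 0 < b) (hb2 : b ≤ 2) (hp : 0 < b + ℓ)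
    (hq : 0 < b - ℓ) (hs : 3 ≤ s) (hst : s ≤ t) (hts : t ≤ 2 * s) :
    -(72 * (s ^ b * ((t - s) / s) ^ 2)) ≤ t ^ (b + ℓ) + s ^ (b - ℓ) - t ^ b - s ^ b := by
  have hs0 : 0 < s := by linarith
  have ht0 : 0 < t := by linarith
  have hls : 1 ≤ Real.log s := by
    rw [Real.le_log_iff_exp_le hs0]
    linarith [Real.exp_one_lt_d9]
  have hlt : Real.log s ≤ Real.log t := Real.log_le_log hs0 hst
  have hsb : 0 < s ^ b := by positivity
  have htb : s ^ b ≤ t ^ b := Real.rpow_le_rpow hs0.le hst hb.le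
  have hg := abs_rpow_mul_log_sub_le hb hb2 hs0 hst hts
  rw [abs_of_nonneg (by linarith : 0 ≤ Real.log s)] at hg
  set r := (t - s) / s with hr
  have hr0 : 0 ≤ r := div_nonneg (by linarith) hs0.le
  -- the convexity inequalities, keeping the quadratic term at the point where it has a sign
  have hF : ℓ * (t ^ b * Real.log t - s ^ b * Real.log s) + s ^ b * (ℓ * Real.log s) ^ 2 / 2 ≤
      t ^ (b + ℓ) + s ^ (b - ℓ) - t ^ b - s ^ b := by
    rcases le_total 0 ℓ with h | h
    · have h1 := mul_rpow_mul_log_add_sq_le_rpow_sub (u := t) (p := b + ℓ) (q := b)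
        (by linarith) (by linarith)
      have h2 := mul_rpow_mul_log_le_rpow_sub hs0.le hq hb
      have h3 : s ^ b * (ℓ * Real.log s) ^ 2 ≤ t ^ b * (ℓ * Real.log t) ^ 2 := by gcongr
      simp only [add_sub_cancel_left, sub_sub_cancel_left] at h1 h2
      linarith
    · have h1 := mul_rpow_mul_log_le_rpow_sub ht0.le hp hb
      have h2 := mul_rpow_mul_log_add_sq_le_rpow_sub (u := s) (p := b - ℓ) (q := b)
        (by linarith) (by linarith)
      simp only [add_sub_cancel_left, sub_sub_cancel_left] at h1 h2
      rw [neg_mul ℓ (Real.log s), neg_sq] at h2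
      linarith
  have hg' : |t ^ b * Real.log t - s ^ b * Real.log s| ≤ 12 * (s ^ b * r * Real.log s) := by
    have : 0 ≤ s ^ b * r := by positivity
    nlinarith
  have h4 : -(|ℓ| * (12 * (s ^ b * r * Real.log s))) ≤
      ℓ * (t ^ b * Real.log t - s ^ b * Real.log s) := by
    have := neg_abs_le (ℓ * (t ^ b * Real.log t - s ^ b * Real.log s))
    rw [abs_mul] at this
    linarith [mul_le_mul_of_nonneg_left hg' (abs_nonneg ℓ)]
  have h5 : s ^ b * (ℓ * Real.log s) ^ 2 = s ^ b * (|ℓ| * Real.log s) ^ 2 := by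
    rw [mul_pow, mul_pow, sq_abs]
  have h6 := mul_nonneg hsb.le (sq_nonneg (|ℓ| * Real.log s - 12 * r))
  nlinarith

/-- Replacing the two exponents `b + ℓ` and `b - ℓ` by their mean costs `O(d^(b + η))`, uniformly in
the position of `s < t`, where `d = t - s`. -/
lemma neg_rpow_le_rpow_perturbation {b ℓ β η L t s : ℝ} (hη : 0 < η) (hηb : η ≤ b)
    (hb2 : b + η ≤ 2) (hηβ : 2 * η ≤ β) (hbβ : b + 2 * η ≤ 1 + β) (hp : 0 < b + ℓ)
    (hq : 0 < b - ℓ) (hL : 0 ≤ L) (hs : 0 ≤ s) (hst : s < t) (hd : t - s ≤ 1 / 2)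
    (hℓ : |ℓ| ≤ L * (t - s) ^ β) :
    -((72 + 16 * L * (5 + 2 / η) + 8 * L / η) * (t - s) ^ (b + η)) ≤
      t ^ (b + ℓ) + s ^ (b - ℓ) - t ^ b - s ^ b := by
  have hb : 0 < b := hη.trans_le hηb
  have ht : 0 < t := hs.trans_lt hst
  set d := t - s with hd_def
  have hd0 : 0 < d := by linarith
  have hd1 : d ≤ 1 := by linarith
  have mono : ∀ {p q : ℝ}, q ≤ p → d ^ p ≤ d ^ q := fun h =>
    Real.rpow_le_rpow_of_exponent_ge hd0 hd1 h
  have hdb : 0 < d ^ (b + η) := by positivity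
  have hA : 0 ≤ 16 * L * (5 + 2 / η) := by positivity
  have hB : 0 ≤ 8 * L / η := by positivity
  -- the first-order convexity bound, which suffices for bounded times
  have hF : -(L * d ^ β * |t ^ b * Real.log t - s ^ b * Real.log s|) ≤
      t ^ (b + ℓ) + s ^ (b - ℓ) - t ^ b - s ^ b := by
    have h1 := mul_rpow_mul_log_le_rpow_sub ht.le hp hb
    have h2 := mul_rpow_mul_log_le_rpow_sub hs hq hb
    simp only [add_sub_cancel_left, sub_sub_cancel_left] at h1 h2
    have h3 := neg_abs_le (ℓ * (t ^ b * Real.log t - s ^ b * Real.log s))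
    rw [abs_mul] at h3
    have h4 := mul_le_mul_of_nonneg_right hℓ (abs_nonneg (t ^ b * Real.log t - s ^ b * Real.log s))
    linarith
  rcases le_total s d with hsd | hsd
  · -- near the origin: `s < t ≤ 2d`
    have hg : ∀ u, 0 ≤ u → u ≤ 2 * d → |u ^ b * Real.log u| ≤ 4 * d ^ (b - η) / η := by
      intro u hu hud
      rw [abs_mul, abs_of_nonneg (Real.rpow_nonneg hu b)]
      refine (rpow_mul_abs_log_le hu (by linarith) hη).trans ?_
      gcongr
      calc u ^ (b - η) ≤ (2 * d) ^ (b - η) := Real.rpow_le_rpow hu hud (by linarith)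
        _ = 2 ^ (b - η) * d ^ (b - η) := Real.mul_rpow two_pos.le hd0.le
        _ ≤ 2 ^ (2 : ℝ) * d ^ (b - η) := by
          gcongr
          · norm_num
          · linarith
        _ = _ := by norm_num
    have h1 : |t ^ b * Real.log t - s ^ b * Real.log s| ≤ 8 * d ^ (b - η) / η := by
      refine (abs_sub _ _).trans ((add_le_add (hg t ht.le (by linarith))
        (hg s hs (by linarith))).trans_eq (by ring))
    have h2 : L * d ^ β * |t ^ b * Real.log t - s ^ b * Real.log s| ≤
        8 * L / η * d ^ (b + η) := by
      calc _ ≤ L * d ^ β * (8 * d ^ (b - η) / η) := by gcongr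
        _ = 8 * L / η * (d ^ (β + (b - η))) := by rw [Real.rpow_add hd0]; ring
        _ ≤ _ := mul_le_mul_of_nonneg_left (mono (by linarith)) hB
    nlinarith
  · have hs0 : 0 < s := hd0.trans_le hsd
    rcases le_total 3 s with hs3 | hs3
    · have h1 := neg_sq_le_rpow_perturbation hb (by linarith) hp hq hs3 hst.le (by linarith)
      have h2 : s ^ b * (d / s) ^ 2 ≤ d ^ (b + η) := by
        calc s ^ b * (d / s) ^ 2 = s ^ (b - 2) * d ^ (2 : ℝ) := by
              rw [Real.rpow_sub hs0, div_pow, Real.rpow_two, Real.rpow_two]; ring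
          _ ≤ 1 * d ^ (2 : ℝ) := by
              gcongr
              exact Real.rpow_le_one_of_one_le_of_nonpos (by linarith) (by linarith)
          _ = d ^ (2 : ℝ) := one_mul _
          _ ≤ d ^ (b + η) := mono hb2
      nlinarith
    · have hlog : |Real.log s| ≤ 2 + |Real.log d| := by
        have h1 : Real.log d ≤ Real.log s := Real.log_le_log hd0 hsd
        have h2 : Real.log s ≤ 2 :=
          (Real.log_le_sub_one_of_pos hs0).trans (by linarith)
        rw [abs_le]
        exact ⟨by linarith [neg_abs_le (Real.log d)], by linarith [abs_nonneg (Real.log d)]⟩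
      have hlogd : |Real.log d| ≤ d ^ (-η) / η := by
        simpa using rpow_mul_abs_log_le (b := 0) hd0.le hd1 hη
      have hone : 1 ≤ d ^ (-η) :=
        Real.one_le_rpow_of_pos_of_le_one_of_nonpos hd0 hd1 (by linarith)
      have hfac : 1 + 2 * |Real.log s| ≤ (5 + 2 / η) * d ^ (-η) := by
        calc _ ≤ 5 * 1 + 2 * (d ^ (-η) / η) := by linarith
          _ ≤ 5 * d ^ (-η) + 2 * (d ^ (-η) / η) := by gcongr
          _ = _ := by ring
      have hspow : s ^ (b - 1) ≤ 3 + d ^ (b - 1) := by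
        have hdp : 0 ≤ d ^ (b - 1) := by positivity
        rcases le_total 1 b with h | h
        · calc s ^ (b - 1) ≤ 3 ^ (b - 1) := Real.rpow_le_rpow hs0.le hs3 (by linarith)
            _ ≤ 3 ^ (1 : ℝ) := Real.rpow_le_rpow_of_exponent_le (by norm_num) (by linarith)
            _ ≤ _ := by rw [Real.rpow_one]; linarith
        · have := Real.rpow_le_rpow_of_nonpos hd0 hsd (by linarith : b - 1 ≤ 0)
          linarith
      have h1 := abs_rpow_mul_log_sub_le hb (by linarith) hs0 hst.le (by linarith : t ≤ 2 * s)
      have h2 : L * d ^ β * |t ^ b * Real.log t - s ^ b * Real.log s| ≤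
          16 * L * (5 + 2 / η) * d ^ (b + η) := by
        calc _ ≤ L * d ^ β * (4 * (s ^ b * (d / s)) * ((5 + 2 / η) * d ^ (-η))) := by
              refine mul_le_mul_of_nonneg_left (h1.trans ?_) (by positivity)
              exact mul_le_mul_of_nonneg_left hfac (by positivity)
          _ = 4 * L * (5 + 2 / η) * (d ^ β * d ^ (-η) * d) * s ^ (b - 1) := by
              rw [Real.rpow_sub_one hs0.ne']; ring
          _ ≤ 4 * L * (5 + 2 / η) * (d ^ β * d ^ (-η) * d) * (3 + d ^ (b - 1)) := by gcongr
          _ = 4 * L * (5 + 2 / η) * (3 * d ^ (β + -η + 1) + d ^ (β + -η + b)) := by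
              rw [Real.rpow_add hd0, Real.rpow_add hd0, Real.rpow_add hd0 (β + -η) b,
                Real.rpow_add hd0 β (-η), Real.rpow_one, Real.rpow_sub_one hd0.ne']
              field_simp
          _ ≤ 4 * L * (5 + 2 / η) * (3 * d ^ (b + η) + d ^ (b + η)) := by
              refine mul_le_mul_of_nonneg_left (add_le_add (mul_le_mul_of_nonneg_left
                (mono ?_) (by norm_num)) (mono ?_)) (by positivity) <;> linarith
          _ = _ := by ring
      nlinarith

/-! ### Lower bound for the variance -/

/-- The lower bound on the variance of an increment with `D(x, y)` replaced by its upper bound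
`1/2`, uniformly over pairs of Hurst parameters `x, y` at Hölder distance. -/
lemma exists_variance_lower_bound {K μ ν β L : ℝ} (hK : K ∈ Set.Ioc (0 : ℝ) 1) (hμ : 0 < μ)
    (hν : ν < 1) (hβ : 0 < β) (hL : 0 ≤ L) :
    ∃ δ c : ℝ, 0 < δ ∧ δ ≤ 1 ∧ 0 < c ∧ ∀ t s x y : ℝ, 0 ≤ s → s < t → t - s < δ →
      x ∈ Set.Icc μ ν → y ∈ Set.Icc μ ν → x < β → |x - y| ≤ L * (t - s) ^ β →
      c * (t - s) ^ ((x + y) * K) ≤ t ^ (2 * x * K) + s ^ (2 * y * K) -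
        2 ^ (1 - K) * ((t ^ (x + y) + s ^ (x + y)) ^ K - (t - s) ^ ((x + y) * K)) := by
  obtain ⟨c, hc, h⟩ := exists_bifractional_lower_bound hK
  obtain ⟨hK0, hK1⟩ := hK
  -- `β` and `1 - ν` make the loss `O(d^(b + η))` with `b = (x + y) K`, and `μ K` ensures `η ≤ b`
  set η := min (min β (1 - ν)) (μ * K) / 2 with hη_def
  have hμK : 0 < μ * K := mul_pos hμ hK0
  have hη : 0 < η := by
    have : 0 < min (min β (1 - ν)) (μ * K) := lt_min (lt_min hβ (by linarith)) hμK
    positivity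
  have hη1 : 2 * η ≤ β := by
    have : 2 * η = min (min β (1 - ν)) (μ * K) := by rw [hη_def]; ring
    rw [this]; exact (min_le_left _ _).trans (min_le_left _ _)
  have hη2 : 2 * η ≤ 1 - ν := by
    have : 2 * η = min (min β (1 - ν)) (μ * K) := by rw [hη_def]; ring
    rw [this]; exact (min_le_left _ _).trans (min_le_right _ _)
  have hη3 : 2 * η ≤ μ * K := by
    have : 2 * η = min (min β (1 - ν)) (μ * K) := by rw [hη_def]; ring
    rw [this]; exact min_le_right _ _
  set M := 72 + 16 * L * (5 + 2 / η) + 8 * L / η with hM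
  have hM0 : 0 < M := by positivity
  refine ⟨min (1 / 2) ((c / (2 * M)) ^ (1 / η)), c / 2, by positivity,
    (min_le_left _ _).trans (by norm_num), by positivity, ?_⟩
  intro t s x y hs hst hd hx hy hxβ hxy
  have hd0 : 0 < t - s := by linarith
  have hxy0 : 0 < x + y := by linarith [hx.1, hy.1]
  have hbK : (x + y) * K ≤ x + y := mul_le_of_le_one_right hxy0.le hK1
  have h0 := h (x + y) t s hxy0 (by linarith [hx.2, hy.2]) hs hst.le
  have hℓ : |(x - y) * K| ≤ L * (t - s) ^ β := by
    rw [abs_mul, abs_of_pos hK0]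
    exact (mul_le_of_le_one_right (abs_nonneg _) hK1).trans hxy
  have hxK : 0 < x * K := mul_pos (hμ.trans_le hx.1) hK0
  have hyK : 0 < y * K := mul_pos (hμ.trans_le hy.1) hK0
  -- `b + 2η ≤ 1 + β` is where `x < β` enters: `b ≤ x + y ≤ β + ν`
  have h1 := neg_rpow_le_rpow_perturbation (b := (x + y) * K) (ℓ := (x - y) * K) hη
    (by nlinarith [hx.1, hy.1]) (by linarith [hx.2, hy.2]) hη1 (by linarith [hy.2])
    (by linarith) (by linarith) hL hs hst (hd.le.trans (min_le_left _ _)) hℓ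
  rw [show (x + y) * K + (x - y) * K = 2 * x * K by ring,
    show (x + y) * K - (x - y) * K = 2 * y * K by ring, ← hM, Real.rpow_add hd0] at h1
  have h2 : (t - s) ^ η ≤ c / (2 * M) := by
    have := Real.rpow_le_rpow hd0.le (hd.le.trans (min_le_right _ _)) hη.le
    rwa [← Real.rpow_mul (by positivity), one_div_mul_cancel hη.ne', Real.rpow_one] at this
  have h3 : M * ((t - s) ^ ((x + y) * K) * (t - s) ^ η) ≤ c / 2 * (t - s) ^ ((x + y) * K) := by
    have hp : 0 ≤ (t - s) ^ ((x + y) * K) := by positivity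
    calc _ ≤ M * ((t - s) ^ ((x + y) * K) * (c / (2 * M))) := by gcongr
      _ = _ := by field_simp
  linarith

/-- At scale `d`, exponents at distance `O(d^β)` give powers of `d` of the same order. -/
lemma exp_mul_rpow_min_le_rpow_add {K β L d x y : ℝ} (hK : K ∈ Set.Ioc (0 : ℝ) 1) (hβ : 0 < β)
    (hL : 0 ≤ L) (hd0 : 0 < d) (hd1 : d ≤ 1) (hxy : |x - y| ≤ L * d ^ β) :
    Real.exp (-(L / β)) * d ^ (2 * min x y * K) ≤ d ^ ((x + y) * K) := by
  obtain ⟨hK0, hK1⟩ := hK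
  have e : (x + y) * K = |x - y| * K + 2 * min x y * K := by
    rw [← max_add_min x y, ← max_sub_min_eq_abs' x y]; ring
  rw [e, Real.rpow_add hd0]
  gcongr
  rw [Real.rpow_def_of_pos hd0, Real.exp_le_exp]
  have hlog := (Real.abs_log_mul_self_rpow_lt d β hd0 hd1 hβ).le
  have hl0 : Real.log d ≤ 0 := Real.log_nonpos hd0.le hd1
  have hp : 0 < d ^ β := by positivity
  rw [abs_of_nonpos (mul_nonpos_of_nonpos_of_nonneg hl0 hp.le)] at hlog
  have h1 : |x - y| * K ≤ L * d ^ β := (mul_le_of_le_one_right (abs_nonneg _) hK1).trans hxy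
  calc -(L / β) = L * -(1 / β) := by ring
    _ ≤ L * (Real.log d * d ^ β) := mul_le_mul_of_nonneg_left (by linarith) hL
    _ = Real.log d * (L * d ^ β) := by ring
    _ ≤ _ := mul_le_mul_of_nonpos_left h1 hl0

/-! ### Absolute moments of Gaussian variables -/

lemma integral_abs_pow_gaussianReal (v : ℝ≥0) (m : ℕ) :
    ∫ x, |x| ^ m ∂(gaussianReal 0 v) = √v ^ m * ∫ x, |x| ^ m ∂(gaussianReal 0 1) := by
  have h : gaussianReal 0 v = (gaussianReal 0 1).map (√(v : ℝ) * ·) := by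
    rw [gaussianReal_map_const_mul]
    congr 1
    · simp
    · ext; simp
  rw [h, integral_map (by fun_prop) (by fun_prop), ← integral_const_mul]
  refine integral_congr_ae (.of_forall fun x => ?_)
  simp only [abs_mul, mul_pow, abs_of_nonneg (Real.sqrt_nonneg _)]

lemma integral_abs_pow_gaussianReal_pos (m : ℕ) : 0 < ∫ x, |x| ^ m ∂(gaussianReal 0 1) := by
  have hint : Integrable (fun x : ℝ => |x| ^ m) (gaussianReal 0 1) := by
    have := (memLp_id_gaussianReal (μ := 0) (v := 1) m).integrable_norm_pow'
    simpa using this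
  rw [integral_pos_iff_support_of_nonneg (fun x => by positivity) hint]
  have : (Function.support fun x : ℝ => |x| ^ m) ⊇ {0}ᶜ := fun x hx => by
    have : x ≠ 0 := hx
    simp [this]
  refine lt_of_lt_of_le ?_ (measure_mono this)
  have := nullSingletonClass_gaussianReal (μ := 0) (v := 1) one_ne_zero
  rw [prob_compl_eq_one_sub (measurableSet_singleton _), measure_singleton]
  simp

/-- The absolute moments of a centred Gaussian variable are those of a standard one, scaled by its
standard deviation. -/
lemma integral_abs_pow_of_hasGaussianLaw {Ω : Type*} [MeasurableSpace Ω] {P : Measure Ω}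
    {X : Ω → ℝ} (hX : HasGaussianLaw X P) (h0 : ∫ ω, X ω ∂P = 0) (m : ℕ) :
    ∫ ω, |X ω| ^ m ∂P = √Var[X; P] ^ m * ∫ x, |x| ^ m ∂(gaussianReal 0 1) := by
  have h := hX.map_eq_gaussianReal
  rw [h0] at h
  rw [← integral_map (f := fun x : ℝ => |x| ^ m) hX.aemeasurable (by fun_prop), h,
    integral_abs_pow_gaussianReal, Real.coe_toNNReal _ (variance_nonneg _ _)]

/-! ### Increments of the process -/

lemma bifractionalCov_self {H : ℝ≥0 → ℝ} {K : ℝ} (hK : 0 < K) {t : ℝ≥0}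
    (ht : H t ∈ Set.Ioo (0 : ℝ) 1) : bifractionalCov H K t t = (t : ℝ) ^ (2 * H t * K) := by
  have h0 : (H t + H t) * K ≠ 0 := (mul_pos (by linarith [ht.1]) hK).ne'
  rw [bifractionalCov, mbmD_self ht, sub_self, abs_zero, Real.zero_rpow h0, sub_zero,
    ← Real.mul_rpow (by norm_num) (by positivity),
    show 1 / 2 * ((t : ℝ) ^ (H t + H t) + (t : ℝ) ^ (H t + H t)) = (t : ℝ) ^ (H t + H t) by ring,
    ← Real.rpow_mul t.coe_nonneg, two_mul]

lemma bifractionalCov_le {H : ℝ≥0 → ℝ} {K : ℝ} (hK : 0 < K) {t s : ℝ≥0} (hst : s ≤ t)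
    (ht : H t ∈ Set.Ioo (0 : ℝ) 1) (hs : H s ∈ Set.Ioo (0 : ℝ) 1) :
    2 * bifractionalCov H K t s ≤ 2 ^ (1 - K) * (((t : ℝ) ^ (H t + H s) +
      (s : ℝ) ^ (H t + H s)) ^ K - ((t : ℝ) - s) ^ ((H t + H s) * K)) := by
  have hts : (s : ℝ) ≤ t := hst
  have hd : 0 ≤ (t : ℝ) - s := by linarith
  have ha : 0 < H t + H s := by linarith [ht.1, hs.1]
  have hbr : 0 ≤ ((t : ℝ) ^ (H t + H s) + (s : ℝ) ^ (H t + H s)) ^ K -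
      ((t : ℝ) - s) ^ ((H t + H s) * K) := by
    rw [Real.rpow_mul hd, sub_nonneg]
    refine Real.rpow_le_rpow (by positivity) ?_ hK.le
    have h1 := Real.rpow_le_rpow hd (by linarith [s.coe_nonneg] : (t : ℝ) - s ≤ t) ha.le
    have h2 : 0 ≤ (s : ℝ) ^ (H t + H s) := by positivity
    linarith
  have hD : 2 * mbmD (H t) (H s) ^ K ≤ 2 ^ (1 - K) := by
    have := Real.rpow_le_rpow (mbmD_nonneg ht hs) (mbmD_le_half ht hs) hK.le
    rw [Real.rpow_sub two_pos, Real.rpow_one]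
    calc _ ≤ 2 * (1 / 2 : ℝ) ^ K := by linarith
      _ = _ := by rw [one_div, Real.inv_rpow two_pos.le]; rfl
  rw [bifractionalCov, abs_of_nonneg hd, ← mul_assoc]
  exact mul_le_mul_of_nonneg_right hD hbr

lemma variance_increment_eq {Ω : Type*} [MeasurableSpace Ω] {P : Measure Ω} {K : ℝ} (hK : 0 < K)
    {H : ℝ≥0 → ℝ} (hH : ∀ t, H t ∈ Set.Ioo (0 : ℝ) 1) {B : ℝ≥0 → Ω → ℝ}
    (hB : IsMultifractionalBifractionalBM H K B P) (t s : ℝ≥0) :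
    Var[B t - B s; P] = (t : ℝ) ^ (2 * H t * K) + (s : ℝ) ^ (2 * H s * K) -
      2 * bifractionalCov H K t s := by
  have := hB.isGaussianProcess.isProbabilityMeasure
  have hL := fun u => (hB.isGaussianProcess.hasGaussianLaw_eval u).memLp_two
  rw [variance_sub (hL t) (hL s), ← covariance_self (hL t).aemeasurable,
    ← covariance_self (hL s).aemeasurable, hB.covariance_eq, hB.covariance_eq, hB.covariance_eq,
    bifractionalCov_self hK (hH t), bifractionalCov_self hK (hH s)]
  ring

theorem theorem2 {Ω : Type*} [MeasurableSpace Ω] (P : Measure Ω)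
    (K : ℝ) (hK : K ∈ Set.Ioc (0 : ℝ) 1)
    (H : ℝ≥0 → ℝ) (μ ν : ℝ) (hμ : 0 < μ) (hν : ν < 1) (hH : ∀ t, H t ∈ Set.Icc μ ν)
    (β : ℝ≥0) (hβ : 0 < β) (hHolder : ∃ C : ℝ≥0, HolderWith C β H)
    (hsup : (⨆ t, H t) < (β : ℝ))
    (B : ℝ≥0 → Ω → ℝ) (hB : IsMultifractionalBifractionalBM H K B P) :
    ∃ δ : ℝ, 0 < δ ∧ ∀ m : ℕ, 1 ≤ m → ∃ M : ℝ, 0 < M ∧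
      ∀ s t : ℝ≥0, |(t : ℝ) - (s : ℝ)| < δ →
        M * |(t : ℝ) - (s : ℝ)| ^ ((m : ℝ) * min (H t) (H s) * K) ≤
          ∫ ω, |B t ω - B s ω| ^ m ∂P := by
  obtain ⟨C, hC⟩ := hHolder
  have hβ' : (0 : ℝ) < β := hβ
  have hH01 : ∀ t, H t ∈ Set.Ioo (0 : ℝ) 1 := fun t =>
    ⟨hμ.trans_le (hH t).1, (hH t).2.trans_lt hν⟩
  have hHβ : ∀ t, H t < β := fun t =>
    (le_ciSup ⟨ν, by rintro _ ⟨u, rfl⟩; exact (hH u).2⟩ t).trans_lt hsup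
  have hHol : ∀ t s : ℝ≥0, |H t - H s| ≤ C * |(t : ℝ) - s| ^ (β : ℝ) := fun t s => by
    simpa [Real.dist_eq, NNReal.dist_eq] using hC.dist_le t s
  obtain ⟨δ, c, hδ, hδ1, hc, hvar⟩ :=
    exists_variance_lower_bound hK hμ hν hβ' C.coe_nonneg
  have hc' : 0 < c * Real.exp (-(C / β)) := by positivity
  -- the lower bound for the variance, for ordered times
  have hV : ∀ t s : ℝ≥0, s < t → (t : ℝ) - s < δ →
      c * Real.exp (-(C / β)) * ((t : ℝ) - s) ^ (2 * min (H t) (H s) * K) ≤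
        Var[B t - B s; P] := by
    intro t s hst hd
    have hts : (s : ℝ) < t := hst
    have hd0 : 0 < (t : ℝ) - s := by linarith
    have hxy : |H t - H s| ≤ C * ((t : ℝ) - s) ^ (β : ℝ) := by
      simpa only [abs_of_pos hd0] using hHol t s
    have h1 := hvar t s (H t) (H s) s.coe_nonneg hts hd (hH t) (hH s) (hHβ t) hxy
    have h2 := exp_mul_rpow_min_le_rpow_add hK hβ' C.coe_nonneg hd0 (hd.le.trans hδ1) hxy
    have h3 := bifractionalCov_le hK.1 hst.le (hH01 t) (hH01 s)
    rw [variance_increment_eq hK.1 hH01 hB]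
    have h4 := mul_le_mul_of_nonneg_left h2 hc.le
    linarith
  have hVabs : ∀ t s : ℝ≥0, |(t : ℝ) - s| < δ →
      c * Real.exp (-(C / β)) * |(t : ℝ) - s| ^ (2 * min (H t) (H s) * K) ≤
        Var[B t - B s; P] := by
    intro t s hd
    rcases lt_trichotomy s t with h | rfl | h
    · have hts : (s : ℝ) < t := h
      rw [abs_of_pos (by linarith)] at hd ⊢
      exact hV t s h hd
    · have : 2 * min (H s) (H s) * K ≠ 0 := by
        rw [min_self]
        exact (mul_pos (mul_pos two_pos (hH01 s).1) hK.1).ne'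
      rw [sub_self, abs_zero, Real.zero_rpow this, mul_zero]
      exact variance_nonneg _ _
    · have hts : (t : ℝ) < s := h
      rw [abs_of_neg (by linarith), neg_sub] at hd ⊢
      rw [min_comm, ← neg_sub (B s), variance_neg]
      exact hV s t h hd
  refine ⟨δ, hδ, fun m _ => ⟨√(c * Real.exp (-(C / β))) ^ m *
    ∫ x, |x| ^ m ∂(gaussianReal 0 1), mul_pos (by positivity)
      (integral_abs_pow_gaussianReal_pos m), fun s t hd => ?_⟩⟩
  have hint := fun u => (hB.isGaussianProcess.hasGaussianLaw_eval u).integrable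
  have hmean : ∫ ω, (B t - B s) ω ∂P = 0 := by
    simp only [Pi.sub_apply]
    rw [integral_sub (hint t) (hint s), hB.centred, hB.centred, sub_zero]
  have hmom := integral_abs_pow_of_hasGaussianLaw
    (hB.isGaussianProcess.hasGaussianLaw_sub (s := t) (t := s)) hmean m
  simp only [Pi.sub_apply] at hmom
  rw [hmom, mul_right_comm]
  refine mul_le_mul_of_nonneg_right ?_ (integral_abs_pow_gaussianReal_pos m).le
  have hpow : |(t : ℝ) - s| ^ ((m : ℝ) * min (H t) (H s) * K) =
      √(|(t : ℝ) - s| ^ (2 * min (H t) (H s) * K)) ^ m := by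
    rw [Real.sqrt_eq_rpow, ← Real.rpow_mul (abs_nonneg _), ← Real.rpow_natCast,
      ← Real.rpow_mul (abs_nonneg _)]
    ring_nf
  rw [hpow, ← mul_pow, ← Real.sqrt_mul hc'.le]
  exact pow_le_pow_left₀ (Real.sqrt_nonneg _) (Real.sqrt_le_sqrt (hVabs t s hd)) m
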